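/- A signed graph $(G,\Sigma)$ is a finite graph $G$ (parallel edges are allowed) together with a set $\Sigma\subseteq E(G)$; the edges in $\Sigma$ are called odd. A cycle of $G$ is even if it contains an even number of odd edges; a pair of parallel edges is a cycle of length two. A face of a planar embedding of $G$ is odd if its facial walk contains an odd number of odd edges, counted with multiplicity. Planar embeddings are described, up to homeomorphism, by the cyclic order of the half-edges around each vertex: such a rotation system of a connected graph $G$ with at least one edge is planar if its facial walks, whose number we denote by $f$, satisfy $|V(G)|-|E(G)|+f=2$. **Proposition.** Let $(G,\Sigma)$ be a signed graph such that $G$ is loopless, $2$-connected (that is, $G$ has at least two vertices, is connected, and remains connected after the deletion of any one vertex) and Eulerian (every vertex has even degree). Suppose that $|\Sigma|$ is even and that $G$ has a planar embedding with exactly two odd faces. Then $(G,\Sigma)$ is even cycle decomposable, that is, $E(G)$ can be partitioned into edge sets of even cycles of $(G,\Sigma)$. -/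

import Mathlib

namespace Graph

/-- The degree of a vertex: the number of edges incident with it, where loops count twice. -/
noncomputable def degree {α β : Type*} (G : Graph α β) (v : α) : ℕ :=
  (G.incidenceSet v).ncard + (G.loopSet v).ncard

/-- A graph is Eulerian if all its vertices have even degree. -/
def IsEulerian {α β : Type*} (G : Graph α β) : Prop :=
  ∀ v ∈ G.vertexSet, Even (G.degree v)

/-- A graph is connected if it has a vertex and any two vertices are joined by a walk. -/
def IsConnected {α β : Type*} (G : Graph α β) : Prop :=
  G.vertexSet.Nonempty ∧
    ∀ x ∈ G.vertexSet, ∀ y ∈ G.vertexSet, Relation.ReflTransGen G.Adj x y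

/-- A graph is `2`-connected if it has at least two vertices, is connected, and stays connected
whenever one vertex is deleted. (Two vertices joined by parallel edges are admitted.) -/
def IsTwoConnected {α β : Type*} (G : Graph α β) : Prop :=
  G.vertexSet.Nontrivial ∧ G.IsConnected ∧
    ∀ v ∈ G.vertexSet, (G.deleteVerts {v}).IsConnected

/-- `C` is the edge set of a cycle of `G`: there are distinct vertices `v 0, …, v n` and
distinct edges `e 0, …, e n` such that `e i` joins `v i` to `v (i + 1)`, indices being read
modulo `n + 1`, and `C = {e 0, …, e n}`. A loop is a cycle of length one, and a pair of parallel
edges is a cycle of length two. -/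
def IsCycleEdgeSet {α β : Type*} (G : Graph α β) (C : Set β) : Prop :=
  ∃ (n : ℕ) (v : Fin (n + 1) → α) (e : Fin (n + 1) → β),
    Function.Injective v ∧ Function.Injective e ∧
    (∀ i, G.IsLink (e i) (v i) (v (i + 1))) ∧ Set.range e = C

/-- The signed graph `(G, S)`, whose odd edges are those in `S`, is even cycle decomposable: the
edge set of `G` can be partitioned into cycles each of which has an even number of odd edges. -/
def IsEvenCycleDecomposable {α β : Type*} (G : Graph α β) (S : Set β) : Prop :=
  ∃ 𝒞 : Set (Set β),
    (∀ C ∈ 𝒞, G.IsCycleEdgeSet C ∧ Even (C ∩ S).ncard) ∧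
    𝒞.PairwiseDisjoint id ∧ ⋃₀ 𝒞 = G.edgeSet

/-- A half-edge (dart) of `G`: an edge together with one of its ends. A non-loop edge has exactly
two half-edges. The half-edge `(e, v)` is also read as the edge `e` traversed starting from `v`. -/
@[ext]
structure HalfEdge {α β : Type*} (G : Graph α β) where
  /-- The underlying edge. -/
  edge : β
  /-- The end at which the half-edge is attached. -/
  vert : α
  /-- The vertex is an end of the edge. -/
  inc : G.Inc edge vert

/-- The other half of the same edge. -/
noncomputable def HalfEdge.opp {α β : Type*} {G : Graph α β} (d : G.HalfEdge) : G.HalfEdge :=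
  ⟨d.edge, d.inc.other, d.inc.inc_other⟩

theorem HalfEdge.opp_involutive {α β : Type*} (G : Graph α β) :
    Function.Involutive (HalfEdge.opp : G.HalfEdge → G.HalfEdge) := by
  intro d
  have h1 : G.IsLink d.edge d.vert d.opp.vert := d.inc.isLink_other
  have h2 : G.IsLink d.edge d.opp.vert d.opp.opp.vert := d.opp.inc.isLink_other
  exact HalfEdge.ext rfl (h1.symm.isLink_iff_eq.mp h2)

/-- An embedding of a loopless graph in a closed oriented surface, given up to homeomorphism by
its rotation system: a permutation `rot` of the half-edges which permutes the half-edges attached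
to each vertex in one cycle (the order in which they leave the vertex, say clockwise). -/
structure RotationSystem {α β : Type*} (G : Graph α β) where
  /-- The next half-edge around the same vertex. -/
  rot : Equiv.Perm G.HalfEdge
  /-- The cycles of `rot` are the sets of half-edges attached to a common vertex. -/
  sameCycle_iff : ∀ d d' : G.HalfEdge, rot.SameCycle d d' ↔ d.vert = d'.vert

namespace RotationSystem

/-- The step of a facial walk: the edge `d` is traversed from `d.vert` to its other end, and there
the walk goes on along the half-edge that follows in the rotation. -/
noncomputable def faceStep {α β : Type*} {G : Graph α β} (R : G.RotationSystem) :
    Equiv.Perm G.HalfEdge :=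
  (HalfEdge.opp_involutive G).toPerm.trans R.rot

/-- The faces of the embedding: the cycles of `faceStep`, each of which is the facial walk around
one face. (For a graph with at least one edge and without isolated vertices.) -/
def Face {α β : Type*} {G : Graph α β} (R : G.RotationSystem) : Type _ :=
  Quotient (Equiv.Perm.SameCycle.setoid R.faceStep)

/-- The face whose facial walk traverses the half-edge `d`. -/
noncomputable def faceOf {α β : Type*} {G : Graph α β} (R : G.RotationSystem) (d : G.HalfEdge) : R.Face :=
  Quotient.mk (Equiv.Perm.SameCycle.setoid R.faceStep) d

/-- A face is odd if its facial walk contains an odd number of odd edges; an edge which the facial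
walk traverses twice is counted twice. -/
def IsOddFace {α β : Type*} {G : Graph α β} (R : G.RotationSystem) (S : Set β)
    (F : R.Face) : Prop :=
  Odd {d : G.HalfEdge | R.faceOf d = F ∧ d.edge ∈ S}.ncard

/-- The embedding of a finite connected graph with at least one edge is planar if the surface is
the sphere, that is, if its Euler characteristic is two. -/
def IsPlanar {α β : Type*} {G : Graph α β} (R : G.RotationSystem) : Prop :=
  G.vertexSet.ncard + Nat.card R.Face = G.edgeSet.ncard + 2

end RotationSystem

end Graph

/-- Along the first `k` points of an orbit, the indicators at `y` and at its image under the
permutation differ, modulo two, by the two end points of the segment. -/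
theorem Equiv.Perm.sum_orbit_add {D : Type*} [DecidableEq D] (f : Equiv.Perm D) (d : D) (k : ℕ)
    (y : D) :
    (∑ i ∈ Finset.range k, if (f ^ i) d = y then (1 : ZMod 2) else 0) +
      ((∑ i ∈ Finset.range k, if (f ^ i) d = f y then (1 : ZMod 2) else 0) +
        ((if f y = d then 1 else 0) + if f y = (f ^ k) d then 1 else 0)) = 0 := by
  induction k with
  | zero => simp [CharTwo.add_self_eq_zero]
  | succ k ih =>
    have h1 : (f y = (f ^ (k + 1)) d) = ((f ^ k) d = y) := by
      rw [pow_succ', Equiv.Perm.mul_apply, f.apply_eq_iff_eq]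
      exact propext eq_comm
    rw [Finset.sum_range_succ, Finset.sum_range_succ]
    simp only [h1]
    simp only [eq_comm (a := f y) (b := (f ^ k) d)] at ih
    linear_combination ih + CharTwo.add_self_eq_zero (if (f ^ k) d = y then (1 : ZMod 2) else 0)

namespace Graph

namespace HalfEdge

variable {α β : Type*} {G : Graph α β}

theorem isLink_opp (d : G.HalfEdge) : G.IsLink d.edge d.vert d.opp.vert :=
  d.inc.isLink_other

theorem opp_opp (d : G.HalfEdge) : d.opp.opp = d :=
  opp_involutive G d

theorem eq_or_eq_opp {d d' : G.HalfEdge} (h : d'.edge = d.edge) : d' = d ∨ d' = d.opp := by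
  have hinc := d'.inc
  rw [h] at hinc
  rcases hinc.eq_or_eq_of_isLink d.isLink_opp with hv | hv
  · exact Or.inl (HalfEdge.ext h hv)
  · exact Or.inr (HalfEdge.ext h hv)

theorem vert_ne_opp_vert [G.Loopless] (d : G.HalfEdge) : d.vert ≠ d.opp.vert :=
  d.isLink_opp.ne

theorem ne_opp [G.Loopless] (d : G.HalfEdge) : d ≠ d.opp :=
  fun h => d.vert_ne_opp_vert (congrArg HalfEdge.vert h)

/-- The edge of a half-edge as an element of the edge set. -/
def edgeElem (d : G.HalfEdge) : G.edgeSet :=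
  ⟨d.edge, d.inc.edge_mem⟩

theorem finite (hV : G.vertexSet.Finite) (hE : G.edgeSet.Finite) : Finite G.HalfEdge := by
  have := hV.to_subtype
  have := hE.to_subtype
  refine Finite.of_injective
    (fun d : G.HalfEdge => (d.edgeElem, (⟨d.vert, d.inc.vertex_mem⟩ : G.vertexSet))) ?_
  intro d d' h
  simp only [Prod.mk.injEq, Subtype.mk.injEq, edgeElem] at h
  exact HalfEdge.ext h.1 h.2

theorem exists_of_mem_edgeSet {e : β} (he : e ∈ G.edgeSet) : ∃ d : G.HalfEdge, d.edge = e := by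
  obtain ⟨x, y, hxy⟩ := exists_isLink_of_mem_edgeSet he
  exact ⟨⟨e, x, hxy.inc_left⟩, rfl⟩

open Classical in
theorem filter_edgeElem_eq [Fintype G.HalfEdge] (d : G.HalfEdge) :
    (Finset.univ.filter fun d' : G.HalfEdge => d'.edgeElem = d.edgeElem) = {d, d.opp} := by
  ext d'
  simp only [Finset.mem_filter, Finset.mem_univ, true_and, Finset.mem_insert,
    Finset.mem_singleton]
  constructor
  · exact fun h => eq_or_eq_opp (congrArg Subtype.val h)
  · rintro (rfl | rfl) <;> rfl

open Classical in
theorem sum_edgeElem_eq [G.Loopless] [Fintype G.HalfEdge] {M : Type*} [AddCommMonoid M]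
    (f : G.HalfEdge → M) (d : G.HalfEdge) :
    ∑ d' with d'.edgeElem = d.edgeElem, f d' = f d + f d.opp := by
  rw [filter_edgeElem_eq, Finset.sum_pair d.ne_opp]

end HalfEdge

/-- If `P` is a property of vertices which is preserved along edges of a connected graph, and some
vertex has it, then all have it. -/
theorem IsConnected.forall_of_adj {α β : Type*} {G : Graph α β} (hG : G.IsConnected) {P : α → Prop}
    (hP : ∀ x y, G.Adj x y → P x → P y) {x : α} (hx : x ∈ G.vertexSet) (hPx : P x) {y : α}
    (hy : y ∈ G.vertexSet) : P y := by
  induction hG.2 x hx y hy with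
  | refl => exact hPx
  | tail hab hbc ih => exact hP _ _ hbc (ih hbc.left_mem)

namespace RotationSystem

variable {α β : Type*} {G : Graph α β}

theorem faceStep_apply (R : G.RotationSystem) (d : G.HalfEdge) : R.faceStep d = R.rot d.opp :=
  rfl

theorem faceOf_eq_iff (R : G.RotationSystem) {d d' : G.HalfEdge} :
    R.faceOf d = R.faceOf d' ↔ R.faceStep.SameCycle d d' :=
  Quotient.eq (r := Equiv.Perm.SameCycle.setoid R.faceStep)

theorem faceOf_surjective (R : G.RotationSystem) : Function.Surjective R.faceOf :=
  Quotient.mk_surjective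

theorem faceOf_faceStep (R : G.RotationSystem) (d : G.HalfEdge) :
    R.faceOf (R.faceStep d) = R.faceOf d := by
  rw [faceOf_eq_iff]
  exact ⟨-1, by simp⟩

theorem faceOf_rot (R : G.RotationSystem) (d : G.HalfEdge) :
    R.faceOf (R.rot d) = R.faceOf d.opp := by
  rw [← R.faceOf_faceStep d.opp, faceStep_apply, HalfEdge.opp_opp]

theorem vert_rot (R : G.RotationSystem) (d : G.HalfEdge) : (R.rot d).vert = d.vert :=
  (R.sameCycle_iff _ _).mp ⟨-1, by simp⟩

theorem vert_faceStep (R : G.RotationSystem) (d : G.HalfEdge) :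
    (R.faceStep d).vert = d.opp.vert :=
  R.vert_rot _

theorem rot_induction [Finite G.HalfEdge] (R : G.RotationSystem) {P : G.HalfEdge → Prop} {u : α}
    (hP : ∀ d, d.vert = u → P d → P (R.rot d)) {d d' : G.HalfEdge} (hd : d.vert = u)
    (hd' : d'.vert = u) (h : P d) : P d' := by
  obtain ⟨k, rfl⟩ := ((R.sameCycle_iff d d').mpr (hd.trans hd'.symm)).exists_nat_pow_eq
  clear hd'
  suffices ((R.rot ^ k) d).vert = u ∧ P ((R.rot ^ k) d) from this.2
  induction k with
  | zero => exact ⟨hd, h⟩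
  | succ k ih =>
    rw [pow_succ', Equiv.Perm.mul_apply, vert_rot]
    exact ⟨ih.1, hP _ ih.1 ih.2⟩

end RotationSystem

section Homology

variable {α β : Type*} {G : Graph α β} [Fintype G.HalfEdge]

open Classical in
/-- The boundary map of the graph over the field with two elements. -/
noncomputable def vertexBoundary (G : Graph α β) [Fintype G.HalfEdge] :
    (G.edgeSet → ZMod 2) →ₗ[ZMod 2] (G.vertexSet → ZMod 2) where
  toFun g u := ∑ d : G.HalfEdge with d.vert = (u : α), g d.edgeElem
  map_add' g g' := by
    ext u
    simp [Finset.sum_add_distrib]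
  map_smul' c g := by
    ext u
    simp [Finset.mul_sum]

open Classical in
theorem vertexBoundary_apply (g : G.edgeSet → ZMod 2) (u : G.vertexSet) :
    G.vertexBoundary g u = ∑ d : G.HalfEdge with d.vert = (u : α), g d.edgeElem :=
  rfl

open Classical in
theorem vertexBoundary_single [G.Loopless] (d : G.HalfEdge) :
    G.vertexBoundary (Pi.single d.edgeElem 1) =
      Pi.single ⟨d.vert, d.inc.vertex_mem⟩ 1 + Pi.single ⟨d.opp.vert, d.opp.inc.vertex_mem⟩ 1 := by
  ext u
  rw [vertexBoundary_apply, Finset.sum_filter]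
  have h : ∀ d' : G.HalfEdge,
      (if d'.vert = (u : α) then (Pi.single d.edgeElem 1 : G.edgeSet → ZMod 2) d'.edgeElem else 0) =
        if d'.edgeElem = d.edgeElem then (if d'.vert = (u : α) then 1 else 0) else 0 := by
    intro d'
    simp only [Pi.single_apply]
    split_ifs <;> rfl
  rw [Finset.sum_congr rfl fun d' _ => h d', ← Finset.sum_filter, HalfEdge.sum_edgeElem_eq]
  simp only [Pi.add_apply, Pi.single_apply, Subtype.ext_iff]
  simp only [eq_comm]

theorem finrank_ker_vertexBoundary_le [G.Loopless] [Finite G.vertexSet] [Finite G.edgeSet]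
    (hG : G.IsConnected) :
    Module.finrank (ZMod 2) (LinearMap.ker G.vertexBoundary) + G.vertexSet.ncard ≤
      G.edgeSet.ncard + 1 := by
  classical
  have := Fintype.ofFinite G.vertexSet
  have := Fintype.ofFinite G.edgeSet
  obtain ⟨x₀, hx₀⟩ := hG.1
  set L : Submodule (ZMod 2) (G.vertexSet → ZMod 2) :=
    LinearMap.range G.vertexBoundary ⊔ Submodule.span (ZMod 2) {Pi.single ⟨x₀, hx₀⟩ 1} with hL
  have hsingle : ∀ y (hy : y ∈ G.vertexSet), (Pi.single ⟨y, hy⟩ 1 : G.vertexSet → ZMod 2) ∈ L := by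
    intro y hy
    refine hG.forall_of_adj
      (P := fun y => ∀ hy : y ∈ G.vertexSet, (Pi.single ⟨y, hy⟩ 1 : G.vertexSet → ZMod 2) ∈ L)
      ?_ hx₀ ?_ hy hy
    · rintro x y ⟨e, he⟩ hx hy
      let d : G.HalfEdge := ⟨e, x, he.inc_left⟩
      have hd : d.opp.vert = y := he.isLink_iff_eq.mp d.isLink_opp
      have h1 : G.vertexBoundary (Pi.single d.edgeElem 1) ∈ L :=
        Submodule.mem_sup_left (LinearMap.mem_range_self _ _)
      rw [vertexBoundary_single] at h1
      have h2 := L.sub_mem h1 (hx he.left_mem)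
      simp only [hd, d, add_sub_cancel_left] at h2
      exact h2
    · intro _
      exact Submodule.mem_sup_right (Submodule.mem_span_singleton_self _)
  have htop : L = ⊤ := by
    rw [eq_top_iff, ← (Pi.basisFun (ZMod 2) G.vertexSet).span_eq, Submodule.span_le]
    rintro _ ⟨⟨y, hy⟩, rfl⟩
    simpa using hsingle y hy
  have h1 := Submodule.finrank_add_le_finrank_add_finrank (LinearMap.range G.vertexBoundary)
    (Submodule.span (ZMod 2) {(Pi.single ⟨x₀, hx₀⟩ 1 : G.vertexSet → ZMod 2)})
  rw [← hL, htop, finrank_top, Module.finrank_fintype_fun_eq_card] at h1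
  have h2 := finrank_span_le_card (R := ZMod 2)
    ({Pi.single ⟨x₀, hx₀⟩ 1} : Set (G.vertexSet → ZMod 2))
  have h3 := LinearMap.finrank_range_add_finrank_ker G.vertexBoundary
  rw [Module.finrank_fintype_fun_eq_card] at h3
  rw [← Nat.card_coe_set_eq, ← Nat.card_coe_set_eq, Nat.card_eq_fintype_card,
    Nat.card_eq_fintype_card]
  simp only [Set.toFinset_singleton, Finset.card_singleton] at h2
  omega

namespace RotationSystem

open Classical in
theorem sum_rot (R : G.RotationSystem) {M : Type*} [AddCommMonoid M] (f : G.HalfEdge → M) (u : α) :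
    ∑ d with d.vert = u, f (R.rot d) = ∑ d with d.vert = u, f d := by
  simp only [Finset.sum_filter]
  rw [← Equiv.sum_comp R.rot fun d => if d.vert = u then f d else 0]
  simp only [vert_rot]

open Classical in
/-- The boundary map from faces to edges over the field with two elements. -/
noncomputable def faceBoundary (R : G.RotationSystem) :
    (R.Face → ZMod 2) →ₗ[ZMod 2] (G.edgeSet → ZMod 2) where
  toFun h e := ∑ d : G.HalfEdge with d.edgeElem = e, h (R.faceOf d)
  map_add' g g' := by
    ext u
    simp [Finset.sum_add_distrib]
  map_smul' c g := by
    ext u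
    simp [Finset.mul_sum]

theorem faceBoundary_edgeElem [G.Loopless] (R : G.RotationSystem) (h : R.Face → ZMod 2)
    (d : G.HalfEdge) :
    R.faceBoundary h d.edgeElem = h (R.faceOf d) + h (R.faceOf d.opp) := by
  classical
  exact HalfEdge.sum_edgeElem_eq (fun d' => h (R.faceOf d')) d

theorem range_faceBoundary_le [G.Loopless] (R : G.RotationSystem) :
    LinearMap.range R.faceBoundary ≤ LinearMap.ker G.vertexBoundary := by
  classical
  rintro _ ⟨h, rfl⟩
  rw [LinearMap.mem_ker]
  ext u
  rw [vertexBoundary_apply]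
  simp only [faceBoundary_edgeElem, ← faceOf_rot]
  rw [Finset.sum_add_distrib, R.sum_rot fun d => h (R.faceOf d)]
  exact CharTwo.add_self_eq_zero _

theorem finrank_ker_faceBoundary_le [G.Loopless] (R : G.RotationSystem) (hG : G.IsConnected) :
    Module.finrank (ZMod 2) (LinearMap.ker R.faceBoundary) ≤ 1 := by
  have hle : LinearMap.ker R.faceBoundary ≤
      Submodule.span (ZMod 2) {(fun _ => 1 : R.Face → ZMod 2)} := by
    intro h hh
    rw [LinearMap.mem_ker] at hh
    have hopp : ∀ d, h (R.faceOf d.opp) = h (R.faceOf d) := by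
      intro d
      rw [eq_comm, ← CharTwo.add_eq_zero, ← faceBoundary_edgeElem, hh, Pi.zero_apply]
    rw [Submodule.mem_span_singleton]
    rcases isEmpty_or_nonempty G.HalfEdge with _ | ⟨⟨d₀⟩⟩
    · have : IsEmpty R.Face := ⟨fun F => isEmptyElim (R.faceOf_surjective F).choose⟩
      exact ⟨0, Subsingleton.elim _ _⟩
    · refine ⟨h (R.faceOf d₀), ?_⟩
      have hvert : ∀ d d' : G.HalfEdge, d.vert = d'.vert →
          h (R.faceOf d) = h (R.faceOf d₀) → h (R.faceOf d') = h (R.faceOf d₀) := by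
        intro d d' hdd' hd
        refine R.rot_induction (P := fun d => h (R.faceOf d) = h (R.faceOf d₀))
          (fun d _ hd => ?_) hdd' rfl hd
        rw [faceOf_rot, hopp, hd]
      have hall : ∀ d, h (R.faceOf d) = h (R.faceOf d₀) := by
        intro d
        refine hG.forall_of_adj
          (P := fun x => ∀ d : G.HalfEdge, d.vert = x → h (R.faceOf d) = h (R.faceOf d₀))
          ?_ d₀.inc.vertex_mem (fun d hd => hvert d₀ d hd.symm rfl) d.inc.vertex_mem d rfl
        rintro x y ⟨e, he⟩ hx d hd
        let d₁ : G.HalfEdge := ⟨e, x, he.inc_left⟩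
        have hd₁ : d₁.opp.vert = y := he.isLink_iff_eq.mp d₁.isLink_opp
        refine hvert d₁.opp d (hd₁.trans hd.symm) ?_
        rw [hopp]
        exact hx d₁ rfl
      ext F
      obtain ⟨d, rfl⟩ := R.faceOf_surjective F
      simp [hall d]
  have h1 := Submodule.finrank_mono hle
  have h2 := finrank_span_le_card (R := ZMod 2) ({fun _ => 1} : Set (R.Face → ZMod 2))
  simp only [Set.toFinset_singleton, Finset.card_singleton] at h2
  omega

theorem IsPlanar.range_faceBoundary [G.Loopless] [Finite G.vertexSet] [Finite G.edgeSet]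
    {R : G.RotationSystem} (hR : R.IsPlanar) (hG : G.IsConnected) :
    LinearMap.range R.faceBoundary = LinearMap.ker G.vertexBoundary := by
  classical
  have : Finite R.Face := Finite.of_surjective _ R.faceOf_surjective
  have := Fintype.ofFinite R.Face
  refine Submodule.eq_of_le_of_finrank_le R.range_faceBoundary_le ?_
  have h1 := finrank_ker_vertexBoundary_le hG
  have h2 := R.finrank_ker_faceBoundary_le hG
  have h3 := LinearMap.finrank_range_add_finrank_ker R.faceBoundary
  rw [Module.finrank_fintype_fun_eq_card, ← Nat.card_eq_fintype_card] at h3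
  unfold IsPlanar at hR
  omega

/-- In a planar embedding of a `2`-connected graph, facial walks do not repeat vertices. -/
theorem IsPlanar.eq_of_vert_eq [G.Loopless] [Finite G.vertexSet] [Finite G.edgeSet]
    {R : G.RotationSystem} (hR : R.IsPlanar) (hG : G.IsTwoConnected) {d d' : G.HalfEdge}
    (hv : d.vert = d'.vert) (hf : R.faceOf d = R.faceOf d') : d = d' := by
  classical
  by_contra hne
  obtain ⟨k, hk⟩ := (R.faceOf_eq_iff.mp hf).exists_nat_pow_eq
  set s : G.HalfEdge → ZMod 2 :=
    fun y => ∑ i ∈ Finset.range k, if (R.faceStep ^ i) d = y then 1 else 0 with hs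
  have hsrot : ∀ x, s x.opp = s (R.rot x) +
      ((if R.rot x = d then 1 else 0) + if R.rot x = d' then 1 else 0) := by
    intro x
    have h := Equiv.Perm.sum_orbit_add R.faceStep d k x.opp
    rw [hk, faceStep_apply, HalfEdge.opp_opp] at h
    exact CharTwo.add_eq_zero.mp h
  set z : G.edgeSet → ZMod 2 := fun e => ∑ x with x.edgeElem = e, s x with hz
  have hzs : ∀ x, z x.edgeElem = s x + s x.opp := HalfEdge.sum_edgeElem_eq s
  have hker : z ∈ LinearMap.ker G.vertexBoundary := by
    rw [LinearMap.mem_ker]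
    ext u
    simp only [vertexBoundary_apply, hzs, hsrot]
    rw [Finset.sum_add_distrib, Finset.sum_add_distrib, R.sum_rot s,
      R.sum_rot fun x => (if x = d then (1 : ZMod 2) else 0) + if x = d' then 1 else 0,
      ← add_assoc, CharTwo.add_self_eq_zero, zero_add, Finset.sum_add_distrib]
    simp only [Finset.sum_ite_eq', Finset.mem_filter, Finset.mem_univ, true_and, hv]
    exact CharTwo.add_self_eq_zero _
  rw [← hR.range_faceBoundary hG.2.1] at hker
  obtain ⟨h, hh⟩ := hker
  set a : G.HalfEdge → ZMod 2 := fun x => h (R.faceOf x) + s x with ha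
  have hopp : ∀ x, a x.opp = a x := by
    intro x
    rw [eq_comm, ← CharTwo.add_eq_zero]
    have h1 := R.faceBoundary_edgeElem h x
    rw [hh, hzs] at h1
    calc a x + a x.opp = (h (R.faceOf x) + h (R.faceOf x.opp)) + (s x + s x.opp) := by
          simp only [ha]; ring
      _ = 0 := by rw [h1]; exact CharTwo.add_self_eq_zero _
  have hrot : ∀ x, a (R.rot x) = a x +
      ((if R.rot x = d then 1 else 0) + if R.rot x = d' then 1 else 0) := by
    intro x
    rw [← hopp x]
    simp only [ha, hsrot, faceOf_rot]
    rw [add_assoc, add_assoc, CharTwo.add_self_eq_zero, add_zero]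
  have hconst : ∀ x y : G.HalfEdge, x.vert ≠ d.vert → x.vert = y.vert → a x = a d →
      a y = a d := by
    intro x y hx hxy hax
    refine R.rot_induction (P := fun x => a x = a d) (u := y.vert) (fun w hw haw => ?_) hxy rfl hax
    have h1 : R.rot w ≠ d := fun h => hx (by rw [hxy, ← hw, ← h, vert_rot])
    have h2 : R.rot w ≠ d' := fun h => hx (by rw [hxy, ← hw, hv, ← h, vert_rot])
    rw [hrot, if_neg h1, if_neg h2, add_zero, add_zero, haw]
  set p := R.rot.symm d with hp
  have hpd : R.rot p = d := R.rot.apply_symm_apply d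
  have hpv : p.vert = d.vert := by rw [← R.vert_rot p, hpd]
  have hap : a d = a p + 1 := by
    have h1 := hrot p
    rwa [hpd, if_pos rfl, if_neg hne, add_zero] at h1
  have hcon := hG.2.2 d.vert d.inc.vertex_mem
  have hmem : ∀ x : G.HalfEdge, x.vert = d.vert →
      x.opp.vert ∈ (G.deleteVerts {d.vert}).vertexSet := by
    intro x hx
    rw [vertexSet_deleteVerts]
    exact ⟨x.opp.inc.vertex_mem, fun h => x.vert_ne_opp_vert (hx.trans h.symm)⟩
  have hall := hcon.forall_of_adj
    (P := fun y => ∀ x : G.HalfEdge, x.vert = y → a x = a d) ?_ (hmem d rfl) ?_ (hmem p hpv)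
    p.opp rfl
  · rw [hopp, hap] at hall
    simp at hall
  · rintro x y ⟨e, he⟩ hx w hw
    obtain ⟨he, -, hy⟩ := (deleteVerts_isLink _ _).mp he
    let w₁ : G.HalfEdge := ⟨e, x, he.inc_left⟩
    have hw₁ : w₁.opp.vert = y := he.isLink_iff_eq.mp w₁.isLink_opp
    refine hconst w₁.opp w (fun h => hy (hw₁.symm.trans h)) (hw₁.trans hw.symm) ?_
    rw [hopp]
    exact hx w₁ rfl
  · intro x hx
    exact hconst d.opp x d.vert_ne_opp_vert.symm hx.symm (hopp d)

/-- The faces of a planar embedding of a connected Eulerian graph can be properly `2`-coloured. -/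
theorem IsPlanar.exists_coloring [G.Loopless] [Finite G.vertexSet] [Finite G.edgeSet]
    {R : G.RotationSystem} (hR : R.IsPlanar) (hG : G.IsConnected) (hEul : G.IsEulerian) :
    ∃ h : R.Face → ZMod 2, ∀ d, h (R.faceOf d) + h (R.faceOf d.opp) = 1 := by
  classical
  have hker : (fun _ => 1) ∈ LinearMap.ker G.vertexBoundary := by
    rw [LinearMap.mem_ker]
    ext u
    have hdeg := hEul u u.2
    have hloop : G.loopSet (u : α) = ∅ := by
      ext e
      simp [not_isLoopAt]
    have himage : HalfEdge.edge '' {d : G.HalfEdge | d.vert = (u : α)} = G.incidenceSet (u : α) := by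
      ext e
      constructor
      · rintro ⟨d, hd, rfl⟩
        rw [mem_incidenceSet, ← (hd : d.vert = u)]
        exact d.inc
      · exact fun he => ⟨⟨e, u, he⟩, rfl, rfl⟩
    have hinj : Set.InjOn HalfEdge.edge {d : G.HalfEdge | d.vert = (u : α)} :=
      fun d hd d' hd' h => HalfEdge.ext h (Eq.trans hd (Eq.symm hd'))
    rw [degree, hloop, Set.ncard_empty, add_zero, ← himage, hinj.ncard_image,
      Set.ncard_eq_toFinset_card', Set.toFinset_ofPred] at hdeg
    rw [vertexBoundary_apply, Finset.sum_const, nsmul_one]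
    exact (ZMod.natCast_eq_zero_iff_even).mpr hdeg
  rw [← hR.range_faceBoundary hG] at hker
  obtain ⟨h, hh⟩ := hker
  refine ⟨h, fun d => ?_⟩
  rw [← faceBoundary_edgeElem, hh]

end RotationSystem

end Homology

namespace RotationSystem

variable {α β : Type*} {G : Graph α β}

/-- A facial walk without repeated vertices and edges is a cycle. -/
theorem isCycleEdgeSet_face [Finite G.HalfEdge] (R : G.RotationSystem) (F : R.Face)
    (hvert : Set.InjOn HalfEdge.vert {d : G.HalfEdge | R.faceOf d = F})
    (hedge : Set.InjOn HalfEdge.edge {d : G.HalfEdge | R.faceOf d = F}) :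
    G.IsCycleEdgeSet (HalfEdge.edge '' {d : G.HalfEdge | R.faceOf d = F}) := by
  obtain ⟨d, rfl⟩ := R.faceOf_surjective F
  obtain ⟨n, hn⟩ : ∃ n, Function.minimalPeriod R.faceStep d = n + 1 :=
    Nat.exists_eq_succ_of_ne_zero (Function.minimalPeriod_pos_of_mem_periodicPts
      (R.faceStep.injective.mem_periodicPts d)).ne'
  let x : Fin (n + 1) → G.HalfEdge := fun i => R.faceStep^[i] d
  have hmem : ∀ k : ℕ, R.faceOf (R.faceStep^[k] d) = R.faceOf d := by
    intro k
    induction k with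
    | zero => rfl
    | succ k ih => rw [Function.iterate_succ_apply', faceOf_faceStep, ih]
  have hinj : Function.Injective x := by
    intro i j hij
    refine Fin.ext (Function.iterate_injOn_Iio_minimalPeriod (f := R.faceStep) (x := d) ?_ ?_ hij)
    · exact i.2.trans_eq hn.symm
    · exact j.2.trans_eq hn.symm
  have hsucc : ∀ i, x (i + 1) = R.faceStep (x i) := by
    intro i
    simp only [x]
    rw [← Function.iterate_succ_apply' R.faceStep, ← Function.iterate_mod_minimalPeriod_eq
      (n := (i : ℕ).succ), hn, Fin.val_add, Fin.val_one', Nat.add_mod_mod]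
  refine ⟨n, fun i => (x i).vert, fun i => (x i).edge,
    fun i j h => hinj (hvert (hmem i) (hmem j) h), fun i j h => hinj (hedge (hmem i) (hmem j) h),
    fun i => ?_, ?_⟩
  · simp only [hsucc, vert_faceStep]
    exact (x i).isLink_opp
  · ext e
    constructor
    · rintro ⟨i, rfl⟩
      exact ⟨x i, hmem i, rfl⟩
    · rintro ⟨d', hd', rfl⟩
      obtain ⟨k, hk⟩ := (R.faceOf_eq_iff.mp (Eq.symm hd')).exists_nat_pow_eq
      have hlt : k % (n + 1) < n + 1 := Nat.mod_lt _ n.succ_pos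
      refine ⟨⟨k % (n + 1), hlt⟩, ?_⟩
      simp only [x]
      rw [← hn, Function.iterate_mod_minimalPeriod_eq, ← Equiv.Perm.coe_pow, hk]

section Coloring

variable {R : G.RotationSystem} {h : R.Face → ZMod 2}

theorem injOn_edge_of_coloring (hh : ∀ d, h (R.faceOf d) + h (R.faceOf d.opp) = 1) (c : ZMod 2) :
    Set.InjOn HalfEdge.edge {d : G.HalfEdge | h (R.faceOf d) = c} := by
  intro d hd d' hd' hdd'
  rcases HalfEdge.eq_or_eq_opp hdd' with rfl | rfl
  · rfl
  · have := hh d'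
    rw [Set.mem_ofPred_eq] at hd hd'
    rw [hd, hd', CharTwo.add_self_eq_zero] at this
    exact absurd this zero_ne_one

theorem exists_halfEdge_of_coloring (hh : ∀ d, h (R.faceOf d) + h (R.faceOf d.opp) = 1)
    (c : ZMod 2) {e : β} (he : e ∈ G.edgeSet) :
    ∃ d : G.HalfEdge, h (R.faceOf d) = c ∧ d.edge = e := by
  obtain ⟨d, rfl⟩ := HalfEdge.exists_of_mem_edgeSet he
  have key : ∀ a b c : ZMod 2, a + b = 1 → a = c ∨ b = c := by decide
  rcases key _ _ c (hh d) with hd | hd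
  · exact ⟨d, hd, rfl⟩
  · exact ⟨d.opp, hd, rfl⟩

/-- In a proper `2`-colouring of the faces, the odd edges are counted by the faces of one colour. -/
theorem sum_ncard_of_coloring [Finite G.HalfEdge] [Fintype R.Face]
    (hh : ∀ d, h (R.faceOf d) + h (R.faceOf d.opp) = 1) (c : ZMod 2) {S : Set β}
    (hS : S ⊆ G.edgeSet) :
    ∑ F with h F = c, {d : G.HalfEdge | R.faceOf d = F ∧ d.edge ∈ S}.ncard = S.ncard := by
  classical
  have := Fintype.ofFinite G.HalfEdge
  have himage : HalfEdge.edge '' {d : G.HalfEdge | h (R.faceOf d) = c ∧ d.edge ∈ S} = S := by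
    ext e
    constructor
    · rintro ⟨d, hd, rfl⟩
      exact hd.2
    · intro he
      obtain ⟨d, hd, rfl⟩ := exists_halfEdge_of_coloring hh c (hS he)
      exact ⟨d, ⟨hd, he⟩, rfl⟩
  rw [← himage,
    ((injOn_edge_of_coloring hh c).mono fun d hd => hd.1).ncard_image, himage]
  simp only [Set.ncard_eq_toFinset_card', Set.toFinset_ofPred]
  rw [Finset.card_eq_sum_card_fiberwise (f := R.faceOf) (t := Finset.univ.filter fun F => h F = c)]
  · refine Finset.sum_congr rfl fun F hF => congrArg Finset.card ?_
    rw [Finset.filter_filter]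
    refine Finset.filter_congr fun d _ => ?_
    simp only [Finset.mem_filter, Finset.mem_univ, true_and] at hF
    constructor
    · rintro ⟨rfl, hd⟩
      exact ⟨⟨hF, hd⟩, rfl⟩
    · rintro ⟨⟨-, hd⟩, hdF⟩
      exact ⟨hdF, hd⟩
  · intro d hd
    simp only [Finset.coe_filter, Finset.mem_univ, true_and, Set.mem_ofPred_eq] at hd ⊢
    exact hd.1

/-- If the number of odd edges is even and there are exactly two odd faces, then these have the same
colour. -/
theorem exists_color_not_isOddFace [Finite G.HalfEdge]
    (hh : ∀ d, h (R.faceOf d) + h (R.faceOf d.opp) = 1) {S : Set β}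
    (hS : S ⊆ G.edgeSet) (hSeven : Even S.ncard)
    (hodd : {F : R.Face | R.IsOddFace S F}.ncard = 2) :
    ∃ c, ∀ F, h F = c → ¬ R.IsOddFace S F := by
  classical
  have : Finite R.Face := Finite.of_surjective _ R.faceOf_surjective
  have := Fintype.ofFinite R.Face
  obtain ⟨F₁, F₂, -, hpair⟩ := Set.ncard_eq_two.mp hodd
  have hiff : ∀ F, R.IsOddFace S F ↔ F = F₁ ∨ F = F₂ := fun F => by
    have := Set.ext_iff.mp hpair F
    simpa using this
  have hcolor : h F₂ = h F₁ := by
    by_contra hne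
    have hsum := sum_ncard_of_coloring hh (h F₁) hS
    rw [← Finset.add_sum_erase _ _ (a := F₁) (by simp)] at hsum
    have hrest : Even (∑ F ∈ (Finset.univ.filter fun F => h F = h F₁).erase F₁,
        {d : G.HalfEdge | R.faceOf d = F ∧ d.edge ∈ S}.ncard) := by
      refine Finset.even_sum _ fun F hF => ?_
      rw [Finset.mem_erase, Finset.mem_filter] at hF
      rw [← Nat.not_odd_iff_even]
      intro ho
      rcases (hiff F).mp ho with rfl | rfl
      · exact hF.1 rfl
      · exact hne hF.2.2
    have h₁ : R.IsOddFace S F₁ := (hiff F₁).mpr (Or.inl rfl)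
    rw [← hsum] at hSeven
    exact Nat.not_even_iff_odd.mpr (Odd.add_even h₁ hrest) hSeven
  refine ⟨h F₁ + 1, fun F hc ho => ?_⟩
  have hF₁ : h F = h F₁ := by
    rcases (hiff F).mp ho with rfl | rfl
    · rfl
    · exact hcolor
  rw [hF₁] at hc
  simp at hc

end Coloring

end RotationSystem

end Graph

open Graph in
theorem proposition5p1 {α β : Type*} (G : Graph α β) (S : Set β)
    (hV : G.vertexSet.Finite) (hE : G.edgeSet.Finite)
    (hS : S ⊆ G.edgeSet)
    (h2 : G.IsTwoConnected) (hEul : G.IsEulerian) (hloop : G.Loopless)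
    (hSeven : Even S.ncard)
    (hemb : ∃ R : G.RotationSystem,
      R.IsPlanar ∧ {F : R.Face | R.IsOddFace S F}.ncard = 2) :
    G.IsEvenCycleDecomposable S := by
  obtain ⟨R, hR, hodd⟩ := hemb
  have := hV.to_subtype
  have := hE.to_subtype
  have := HalfEdge.finite hV hE
  have := Fintype.ofFinite G.HalfEdge
  obtain ⟨h, hh⟩ := hR.exists_coloring h2.2.1 hEul
  obtain ⟨c, hc⟩ := RotationSystem.exists_color_not_isOddFace hh hS hSeven hodd
  have hinj := RotationSystem.injOn_edge_of_coloring hh c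
  have hsub : ∀ F, h F = c → {d : G.HalfEdge | R.faceOf d = F} ⊆ {d | h (R.faceOf d) = c} := by
    rintro F hF d rfl
    exact hF
  refine ⟨(fun F => HalfEdge.edge '' {d : G.HalfEdge | R.faceOf d = F}) '' {F | h F = c},
    ?_, ?_, ?_⟩
  · rintro _ ⟨F, hF, rfl⟩
    refine ⟨R.isCycleEdgeSet_face F ?_ (hinj.mono (hsub F hF)), ?_⟩
    · intro d hd d' hd' hv
      exact hR.eq_of_vert_eq h2 hv (Eq.trans hd (Eq.symm hd'))
    · have heq : HalfEdge.edge '' {d : G.HalfEdge | R.faceOf d = F} ∩ S =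
          HalfEdge.edge '' {d : G.HalfEdge | R.faceOf d = F ∧ d.edge ∈ S} := by
        ext e
        constructor
        · rintro ⟨⟨d, hd, rfl⟩, he⟩
          exact ⟨d, ⟨hd, he⟩, rfl⟩
        · rintro ⟨d, hd, rfl⟩
          exact ⟨⟨d, hd.1, rfl⟩, hd.2⟩
      simp only [heq]
      rw [(hinj.mono fun d hd => hsub F hF hd.1).ncard_image, ← Nat.not_odd_iff_even]
      exact hc F hF
  · rintro _ ⟨F, hF, rfl⟩ _ ⟨F', hF', rfl⟩ hne
    refine Set.disjoint_left.mpr ?_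
    rintro _ ⟨d, hd, rfl⟩ ⟨d', hd', hdd'⟩
    have hddeq := hinj (hsub F' hF' hd') (hsub F hF hd) hdd'
    refine hne ?_
    rw [Set.mem_ofPred_eq] at hd hd'
    rw [← hd, ← hd', hddeq]
  · ext e
    constructor
    · rintro ⟨_, ⟨F, hF, rfl⟩, d, hd, rfl⟩
      exact d.inc.edge_mem
    · intro he
      obtain ⟨d, hd, rfl⟩ := RotationSystem.exists_halfEdge_of_coloring hh c he
      exact ⟨_, ⟨R.faceOf d, hd, rfl⟩, d, rfl, rfl⟩
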